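/- **Theorem (Cowling–Haagerup–Howe).** Let $G$ be a locally compact (Hausdorff) group with left Haar measure $ds$, and let $\pi$ be a (strongly continuous) unitary representation of $G$ on a complex Hilbert space $H_\pi$. Suppose that $\pi$ has a cyclic vector $\xi\in H_\pi$ (that is, the linear span of $\{\pi(s)\xi : s\in G\}$ is dense in $H_\pi$) whose matrix coefficient $$\pi_{\xi,\xi}(s)=\langle \pi(s)\xi,\xi\rangle\qquad(s\in G)$$ belongs to $L^{2+\epsilon}(G)$ for every $\epsilon>0$. Then $\pi$ is weakly contained in the left regular representation $\lambda$ of $G$ on $L^2(G)$, $(\lambda(s)g)(t)=g(s^{-1}t)$; that is, $$\|\pi(f)\|\le\|\lambda(f)\|\qquad\text{for every } f\in L^1(G),$$ where, for a unitary representation $\sigma$ of $G$ on $H_\sigma$, $\sigma(f)=\int_G f(s)\sigma(s)\,ds$ is the bounded operator determined by $\langle\sigma(f)\eta,\zeta\rangle=\int_G f(s)\langle\sigma(s)\eta,\zeta\rangle\,ds$ for $\eta,\zeta\in H_\sigma$, and the norms are operator norms. -/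

import Mathlib

open MeasureTheory

/-- A unitary representation of a topological group `G` on a complex Hilbert space `H`: a
homomorphism from `G` to the unitary operators on `H` that is continuous for the strong operator
topology. -/
structure UnitaryRep (G : Type*) [Group G] [TopologicalSpace G]
    (H : Type*) [NormedAddCommGroup H] [InnerProductSpace ℂ H] where
  /-- the underlying homomorphism into the unitary group of `H` -/
  toHom : G →* (H ≃ₗᵢ[ℂ] H)
  /-- strong continuity -/
  continuous_orbit : ∀ ξ : H, Continuous fun s : G => toHom s ξ

namespace UnitaryRep

variable {G : Type*} [Group G] [TopologicalSpace G]
  {H : Type*} [NormedAddCommGroup H] [InnerProductSpace ℂ H]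

/-- The matrix coefficient `s ↦ ⟨π(s)ξ, η⟩`, linear in `ξ` and conjugate linear in `η`
(Mathlib's inner product is linear in its second argument). -/
def coeff (π : UnitaryRep G H) (ξ η : H) (s : G) : ℂ :=
  @inner ℂ H InnerProductSpace.toInner η (π.toHom s ξ)

/-- `ξ` is cyclic for `π`: the linear span of the orbit of `ξ` is dense. -/
def IsCyclicVector (π : UnitaryRep G H) (ξ : H) : Prop :=
  Dense (Submodule.span ℂ (Set.range fun s : G => π.toHom s ξ) : Set H)

theorem continuous_coeff (π : UnitaryRep G H) (ξ η : H) : Continuous (π.coeff ξ η) :=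
  continuous_const.inner (π.continuous_orbit ξ)

theorem norm_coeff_le (π : UnitaryRep G H) (ξ η : H) (s : G) :
    ‖π.coeff ξ η s‖ ≤ ‖η‖ * ‖ξ‖ := by
  simpa [coeff] using norm_inner_le_norm (𝕜 := ℂ) η (π.toHom s ξ)

variable [MeasurableSpace G] [BorelSpace G] {μ : Measure G}

theorem integrable_mul_coeff (π : UnitaryRep G H) (f : G →₁[μ] ℂ) (ξ η : H) :
    Integrable (fun s => f s * π.coeff ξ η s) μ :=
  (L1.integrable_coeFn f).mul_bdd (c := ‖η‖ * ‖ξ‖)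
    (π.continuous_coeff ξ η).measurable.aestronglyMeasurable
    (Filter.Eventually.of_forall fun s => π.norm_coeff_le ξ η s)

/-- The bounded sesquilinear form `(ξ, η) ↦ conj (∫ f(s) ⟨π(s)ξ, η⟩ ds)`, conjugate linear in `ξ`
and linear in `η`. -/
noncomputable def integratedForm (π : UnitaryRep G H) (f : G →₁[μ] ℂ) : H →L⋆[ℂ] H →L[ℂ] ℂ :=
  LinearMap.mkContinuous₂
    (LinearMap.mk₂'ₛₗ (starRingEnd ℂ) (RingHom.id ℂ)
      (fun ξ η : H => starRingEnd ℂ (∫ s, f s * π.coeff ξ η s ∂μ))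
      (by
        intro ξ ξ' η
        rw [← map_add, ← integral_add (π.integrable_mul_coeff f ξ η)
          (π.integrable_mul_coeff f ξ' η)]
        simp [coeff, mul_add, inner_add_right])
      (by
        intro c ξ η
        rw [smul_eq_mul, ← map_mul, ← integral_const_mul]
        simp [coeff, inner_smul_right, mul_left_comm])
      (by
        intro ξ η η'
        rw [← map_add, ← integral_add (π.integrable_mul_coeff f ξ η)
          (π.integrable_mul_coeff f ξ η')]
        simp [coeff, mul_add, inner_add_left])
      (by
        intro c ξ η
        rw [RingHom.id_apply, smul_eq_mul, ← Complex.conj_conj c, ← map_mul, Complex.conj_conj,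
          ← integral_const_mul]
        simp [coeff, inner_smul_left, mul_left_comm]))
    ‖f‖
    (by
      intro ξ η
      simp only [LinearMap.mk₂'ₛₗ_apply, RCLike.norm_conj]
      calc ‖∫ s, f s * π.coeff ξ η s ∂μ‖
          ≤ ∫ s, ‖f s * π.coeff ξ η s‖ ∂μ := norm_integral_le_integral_norm _
        _ ≤ ∫ s, ‖f s‖ * (‖η‖ * ‖ξ‖) ∂μ := by
            refine integral_mono (π.integrable_mul_coeff f ξ η).norm
              ((L1.integrable_coeFn f).norm.mul_const _) fun s => ?_
            simp only [norm_mul]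
            exact mul_le_mul_of_nonneg_left (π.norm_coeff_le ξ η s) (norm_nonneg _)
        _ = ‖f‖ * ‖ξ‖ * ‖η‖ := by
            rw [integral_mul_const, ← L1.norm_eq_integral_norm]
            ring)

/-- The integrated form `π(f) = ∫ f(s) π(s) ds` of `π` at `f ∈ L¹(G)`: the bounded operator with
`⟨π(f)ξ, η⟩ = ∫ f(s) ⟨π(s)ξ, η⟩ ds` for all `ξ` and `η`; see `inner_integrated`. -/
noncomputable def integrated [CompleteSpace H] (π : UnitaryRep G H) (f : G →₁[μ] ℂ) : H →L[ℂ] H :=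
  InnerProductSpace.continuousLinearMapOfBilin (π.integratedForm f)

theorem inner_integrated [CompleteSpace H] (π : UnitaryRep G H) (f : G →₁[μ] ℂ) (ξ η : H) :
    @inner ℂ H InnerProductSpace.toInner η (π.integrated f ξ) = ∫ s, f s * π.coeff ξ η s ∂μ := by
  rw [← inner_conj_symm, integrated, InnerProductSpace.continuousLinearMapOfBilin_apply]
  simp [integratedForm]

/-- `π` is weakly contained in `σ`: `‖π(f)‖ ≤ ‖σ(f)‖` for every `f ∈ L¹(G, μ)`. -/
def WeaklyContained [CompleteSpace H] {K : Type*} [NormedAddCommGroup K] [InnerProductSpace ℂ K]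
    [CompleteSpace K] (μ : Measure G) (π : UnitaryRep G H) (σ : UnitaryRep G K) : Prop :=
  ∀ f : G →₁[μ] ℂ, ‖π.integrated f‖ ≤ ‖σ.integrated f‖

end UnitaryRep

section LeftRegular

variable {G : Type*} [Group G] [TopologicalSpace G] [IsTopologicalGroup G]
  [MeasurableSpace G] [BorelSpace G]

/-- Left translation `(λ(s)g)(t) = g(s⁻¹t)` as a unitary operator on `L²(G, μ)`. -/
noncomputable def leftTranslation (μ : Measure G) [μ.IsMulLeftInvariant] (s : G) :
    Lp ℂ 2 μ ≃ₗᵢ[ℂ] Lp ℂ 2 μ where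
  toFun g := Lp.compMeasurePreserving (fun t => s⁻¹ * t) (measurePreserving_mul_left μ s⁻¹) g
  invFun g := Lp.compMeasurePreserving (fun t => s * t) (measurePreserving_mul_left μ s) g
  map_add' g h := map_add _ g h
  map_smul' c g := (Lp.compMeasurePreservingₗ ℂ _ (measurePreserving_mul_left μ s⁻¹)).map_smul c g
  left_inv g := by
    have h := smul_inv_smul (DomMulAct.mk s) g
    exact h
  right_inv g := by
    have h := inv_smul_smul (DomMulAct.mk s) g
    exact h
  norm_map' g := Lp.norm_compMeasurePreserving _ _

theorem leftTranslation_apply_ae (μ : Measure G) [μ.IsMulLeftInvariant] (s : G) (g : Lp ℂ 2 μ) :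
    ⇑(leftTranslation μ s g) =ᵐ[μ] fun t => g (s⁻¹ * t) :=
  Lp.coeFn_compMeasurePreserving g (measurePreserving_mul_left μ s⁻¹)

/-- The left regular representation of `G` on `L²(G, μ)`. -/
noncomputable def leftRegular [LocallyCompactSpace G] (μ : Measure G) [μ.IsHaarMeasure] [μ.Regular] :
    UnitaryRep G (Lp ℂ 2 μ) where
  toHom :=
    { toFun := leftTranslation μ
      map_one' := by
        ext1 g
        have h := one_smul (Gᵈᵐᵃ) g
        rw [← inv_one] at h
        exact h
      map_mul' := by
        intro s t
        ext1 g
        have h := mul_smul (DomMulAct.mk s⁻¹) (DomMulAct.mk t⁻¹) g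
        rw [← DomMulAct.mk_mul, ← mul_inv_rev] at h
        exact h }
  continuous_orbit g := by
    have : Fact ((2 : ENNReal) ≠ ⊤) := ⟨by simp⟩
    have h : Continuous fun s : G => DomMulAct.mk s⁻¹ • g :=
      (DomMulAct.continuous_mk.comp continuous_inv).smul continuous_const
    exact h

end LeftRegular

/-! For `f` and `g` in `C_c(G, ℂ)` put `T = π(f)* π(f)`, `η = π(g)ξ` and `Λ = ‖λ(f)‖`. Then `‖Tⁿη‖²
= ⟨T²ⁿη, η⟩ = ∫ w π_{ξ,ξ}`, where `w` is built from `g` by `2n` rounds of convolving with `f` and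
applying the adjoint, followed by the adjoint of convolution by `g`.

Two facts control this integral. In `L²`, `‖w‖₂ ≤ ‖λ(g)‖ Λ⁴ⁿ ‖g‖₂`, and `w` lives on a compact set
of measure at most `C M²ⁿ` (`exists_measure_mul_pow_mul_le`). Hölder against `π_{ξ,ξ} ∈ L^{2+ε}`
then gives `‖Tⁿη‖² ≤ C' (Λ² M^δ)²ⁿ` with `δ = 1/2 - 1/(2+ε)`.

Since `T` is self-adjoint, `n ↦ ‖Tⁿη‖` is log-convex, so this growth rate already bounds the first
ratio: `‖Tη‖ ≤ Λ² M^δ ‖η‖`. As `M` does not depend on `ε`, letting `ε → 0` removes `M^δ`. Such `η`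
are dense because `ξ` is cyclic, so `‖π(f)‖² = ‖T‖ ≤ Λ²`; density of `C_c` in `L¹` finishes. -/

open scoped CompactlySupported ComplexConjugate InnerProductSpace Pointwise Topology

/-! ### Twisted convolution of compactly supported functions -/

section TwistedConvolution

variable {G : Type*} [Group G] [TopologicalSpace G] [IsTopologicalGroup G]
  [MeasurableSpace G] [BorelSpace G]

omit [MeasurableSpace G] [BorelSpace G] in
theorem hasCompactSupport_twistedKernel (f g : C_c(G, ℂ)) {θ : G → G} (hθ : Continuous θ) :
    HasCompactSupport fun p : G × G => f p.1 * g ((θ p.1)⁻¹ * p.2) := by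
  refine HasCompactSupport.intro
    (f.hasCompactSupport.isCompact.prod
      ((f.hasCompactSupport.isCompact.image hθ).mul g.hasCompactSupport.isCompact)) ?_
  rintro ⟨s, t⟩ h
  by_contra h0
  have h1 : s ∈ tsupport f := subset_tsupport _ (left_ne_zero_of_mul h0)
  have h2 : (θ s)⁻¹ * t ∈ tsupport g := subset_tsupport _ (right_ne_zero_of_mul h0)
  exact h ⟨h1, θ s, ⟨s, h1, rfl⟩, _, h2, by simp⟩

omit [IsTopologicalGroup G] [BorelSpace G] in
theorem support_twistedConv_subset (μ : Measure G) (f g : C_c(G, ℂ)) (θ : G → G) :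
    (Function.support fun t => ∫ s, f s * g ((θ s)⁻¹ * t) ∂μ) ⊆
      (θ '' Function.support f) * Function.support g := by
  intro t ht
  by_contra h
  refine ht ?_
  have h0 : ∀ s, f s * g ((θ s)⁻¹ * t) = 0 := by
    intro s
    by_contra h0
    exact h ⟨θ s, ⟨s, left_ne_zero_of_mul h0, rfl⟩, _, right_ne_zero_of_mul h0, by simp⟩
  simp [h0]

/-- The function `t ↦ ∫ f(s) g(θ(s)⁻¹ t) ds`. For `θ = id` it is the convolution of `f` and `g`. -/
noncomputable def twistedConv (μ : Measure G) [IsFiniteMeasureOnCompacts μ] (f : C_c(G, ℂ))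
    (θ : C(G, G)) (g : C_c(G, ℂ)) : C_c(G, ℂ) where
  toFun t := ∫ s, f s * g ((θ s)⁻¹ * t) ∂μ
  continuous_toFun := by
    rw [← continuousOn_univ]
    refine continuousOn_integral_of_compact_support f.hasCompactSupport.isCompact ?_ ?_
    · exact Continuous.continuousOn (by fun_prop)
    · intro p x _ hx
      rw [image_eq_zero_of_notMem_tsupport hx, zero_mul]
  hasCompactSupport' :=
    HasCompactSupport.of_support_subset_isCompact
      ((f.hasCompactSupport.isCompact.image θ.continuous).mul g.hasCompactSupport.isCompact)
      ((support_twistedConv_subset μ f g θ).trans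
        (Set.mul_subset_mul (Set.image_mono (subset_tsupport _)) (subset_tsupport _)))

theorem twistedConv_apply (μ : Measure G) [IsFiniteMeasureOnCompacts μ] (f : C_c(G, ℂ))
    (θ : C(G, G)) (g : C_c(G, ℂ)) (t : G) :
    twistedConv μ f θ g t = ∫ s, f s * g ((θ s)⁻¹ * t) ∂μ := rfl

/-- Fubini, then left invariance in `t`. The kernel is continuous with compact support, so no
σ-finiteness is needed. -/
theorem integral_twistedConv_mul (μ : Measure G) [μ.IsMulLeftInvariant]
    [IsFiniteMeasureOnCompacts μ] (f : C_c(G, ℂ)) (θ : C(G, G)) (g : C_c(G, ℂ)) {c : G → ℂ}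
    (hc : Continuous c) :
    ∫ t, twistedConv μ f θ g t * c t ∂μ = ∫ s, f s * ∫ t, g t * c (θ s * t) ∂μ ∂μ := by
  calc ∫ t, twistedConv μ f θ g t * c t ∂μ
      = ∫ t, ∫ s, f s * g ((θ s)⁻¹ * t) * c t ∂μ ∂μ := by
        simp_rw [twistedConv_apply, integral_mul_const]
    _ = ∫ s, ∫ t, f s * g ((θ s)⁻¹ * t) * c t ∂μ ∂μ := by
        symm
        refine integral_integral_swap_of_hasCompactSupport
          (f := fun s t => f s * g ((θ s)⁻¹ * t) * c t) ?_ ?_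
        · simp only [Function.uncurry_def]
          fun_prop
        · exact (hasCompactSupport_twistedKernel f g θ.continuous).mul_right
    _ = _ := by
        refine integral_congr_ae (.of_forall fun s => ?_)
        simp only [mul_assoc, integral_const_mul]
        rw [← integral_mul_left_eq_self (fun t => g ((θ s)⁻¹ * t) * c t) (θ s)]
        simp

end TwistedConvolution

/-! ### Density of `C_c` in `Lᵖ` -/

namespace CompactlySupportedContinuousMap

variable {X : Type*} [TopologicalSpace X] [MeasurableSpace X] [BorelSpace X]
  (μ : Measure X) [IsFiniteMeasureOnCompacts μ]

theorem memLp (g : C_c(X, ℂ)) (p : ENNReal) : MemLp g p μ :=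
  g.continuous.memLp_of_hasCompactSupport g.hasCompactSupport

/-- The class in `Lᵖ` of a continuous function with compact support. -/
noncomputable def toLp (p : ENNReal) (g : C_c(X, ℂ)) : Lp ℂ p μ := (g.memLp μ p).toLp g

theorem coeFn_toLp (p : ENNReal) (g : C_c(X, ℂ)) : ⇑(g.toLp μ p) =ᵐ[μ] g :=
  (g.memLp μ p).coeFn_toLp

-- Squeeze `t` between a compact `K` and an open `U` by regularity and take a Urysohn function: the
-- error is at most `‖c‖` and vanishes off `U \ K`, a set of small measure.
omit [IsFiniteMeasureOnCompacts μ] in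
theorem exists_eLpNorm_sub_indicator_le [T2Space X] [LocallyCompactSpace X] [μ.Regular]
    {p : ENNReal} (hp : p ≠ ⊤) (c : ℂ) {t : Set X} (ht : MeasurableSet t) (hμt : μ t ≠ ⊤)
    {ε : ENNReal} (hε : ε ≠ 0) :
    ∃ g : C_c(X, ℂ), eLpNorm (⇑g - t.indicator fun _ => c) p μ ≤ ε := by
  obtain ⟨η, η0, hη⟩ := exists_eLpNorm_indicator_le (μ := μ) hp c hε
  have hη2 : ((η / 2 : NNReal) : ENNReal) ≠ 0 := by simpa using η0.ne'
  obtain ⟨K, hKt, hK, hμK⟩ := ht.exists_isCompact_sdiff_lt hμt hη2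
  obtain ⟨U, htU, hU, -, hμU⟩ := ht.exists_isOpen_sdiff_lt hμt hη2
  obtain ⟨ψ, hψK, hψU, hψc, hψ⟩ := exists_continuous_one_zero_of_isCompact hK hU.isClosed_compl
    (Set.disjoint_compl_right_iff_subset.2 (hKt.trans htU))
  refine ⟨⟨⟨fun x => (ψ x : ℂ) * c, by fun_prop⟩,
    (hψc.comp_left (g := Complex.ofReal) Complex.ofReal_zero).mul_right⟩,
    (eLpNorm_mono fun x => ?_).trans (hη (U \ K) ?_)⟩
  · change ‖(ψ x : ℂ) * c - t.indicator (fun _ => c) x‖ ≤ _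
    obtain ⟨h0, h1⟩ := hψ x
    by_cases hxK : x ∈ K
    · simp [hψK hxK, hKt hxK]
    by_cases hxU : x ∈ U
    · rw [Set.indicator_of_mem (show x ∈ U \ K from ⟨hxU, hxK⟩) fun _ => c]
      by_cases hxt : x ∈ t
      · have : (ψ x : ℂ) * c - c = ((ψ x - 1 : ℝ) : ℂ) * c := by push_cast; ring
        rw [Set.indicator_of_mem hxt, this, norm_mul, Complex.norm_real, Real.norm_eq_abs]
        exact mul_le_of_le_one_left (norm_nonneg _) (abs_le.2 ⟨by linarith, by linarith⟩)
      · rw [Set.indicator_of_notMem hxt, sub_zero, norm_mul, Complex.norm_real, Real.norm_eq_abs]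
        exact mul_le_of_le_one_left (norm_nonneg _) (abs_le.2 ⟨by linarith, by linarith⟩)
    · have hxt : x ∉ t := fun h => hxU (htU h)
      simp [hψU hxU, hxt]
  · calc μ (U \ K) ≤ μ (U \ t ∪ t \ K) := measure_mono fun x hx => by
          by_cases hxt : x ∈ t
          · exact Or.inr ⟨hxt, hx.2⟩
          · exact Or.inl ⟨hx.1, hxt⟩
      _ ≤ (η / 2 : NNReal) + (η / 2 : NNReal) :=
          (measure_union_le _ _).trans (add_le_add hμU.le hμK.le)
      _ = η := by rw [← ENNReal.coe_add, add_halves]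

theorem denseRange_toLp [T2Space X] [LocallyCompactSpace X] [μ.Regular] {p : ENNReal}
    [Fact (1 ≤ p)] (hp : p ≠ ⊤) : DenseRange (toLp μ p) := by
  intro F
  rw [EMetric.mem_closure_iff]
  intro ε hε
  obtain ⟨δ, hδ, hδε⟩ := exists_between hε
  obtain ⟨_, hg, g, rfl⟩ := (Lp.memLp F).induction_dense hp
    (fun u => u ∈ Set.range fun g : C_c(X, ℂ) => (g : X → ℂ))
    (by
      intro c t ht hμt ε hε
      obtain ⟨g, hg⟩ := exists_eLpNorm_sub_indicator_le μ hp c ht hμt.ne hε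
      exact ⟨g, hg, g, rfl⟩)
    (by
      rintro _ _ ⟨g, rfl⟩ ⟨h, rfl⟩
      exact ⟨g + h, coe_add g h⟩)
    (by
      rintro _ ⟨g, rfl⟩
      exact (g.memLp μ p).1) hδ.ne'
  refine ⟨_, ⟨g, rfl⟩, lt_of_le_of_lt ?_ hδε⟩
  rw [Lp.edist_def]
  refine le_trans (le_of_eq (eLpNorm_congr_ae ?_)) hg
  filter_upwards [coeFn_toLp μ p g] with x hx
  simp only [Pi.sub_apply, hx]

/-- Pointwise complex conjugation. -/
noncomputable def conjugate (g : C_c(X, ℂ)) : C_c(X, ℂ) where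
  toFun t := conj (g t)
  continuous_toFun := by fun_prop
  hasCompactSupport' := g.hasCompactSupport.comp_left (map_zero _)

omit [MeasurableSpace X] [BorelSpace X] in
@[simp] theorem conjugate_apply (g : C_c(X, ℂ)) (t : X) : g.conjugate t = conj (g t) := rfl

omit [MeasurableSpace X] [BorelSpace X] in
theorem support_conjugate (g : C_c(X, ℂ)) :
    Function.support g.conjugate = Function.support g := by
  ext; simp

end CompactlySupportedContinuousMap

/-! ### Integrated forms on `C_c` and density of the vectors `π(g)ξ` -/

namespace UnitaryRep

variable {G : Type*} [Group G] [TopologicalSpace G] [MeasurableSpace G] [BorelSpace G]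
  {H : Type*} [NormedAddCommGroup H] [InnerProductSpace ℂ H] [CompleteSpace H]

section

variable {μ : Measure G}

theorem inner_integrated_adjoint (π : UnitaryRep G H) (f : G →₁[μ] ℂ) (ξ η : H) :
    ⟪η, (π.integrated f).adjoint ξ⟫_ℂ = ∫ s, conj (f s) * ⟪η, π.toHom s⁻¹ ξ⟫_ℂ ∂μ := by
  rw [ContinuousLinearMap.adjoint_inner_right, ← inner_conj_symm, inner_integrated,
    ← integral_conj]
  congr 1
  ext s
  rw [map_mul, coeff, inner_conj_symm, map_inv]
  congr 1
  rw [← LinearIsometryEquiv.inner_map_map (π.toHom s) η]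
  congr 1
  exact (LinearIsometryEquiv.apply_symm_apply _ _).symm

theorem integrated_sub (π : UnitaryRep G H) (f g : G →₁[μ] ℂ) :
    π.integrated (f - g) = π.integrated f - π.integrated g := by
  ext ξ
  refine ext_inner_left ℂ fun η => ?_
  rw [_root_.sub_apply, inner_sub_right, inner_integrated, inner_integrated,
    inner_integrated, ← integral_sub (π.integrable_mul_coeff f ξ η)
    (π.integrable_mul_coeff g ξ η)]
  refine integral_congr_ae ?_
  filter_upwards [Lp.coeFn_sub f g] with s hs
  rw [hs, Pi.sub_apply, sub_mul]

theorem norm_integrated_le (π : UnitaryRep G H) (f : G →₁[μ] ℂ) : ‖π.integrated f‖ ≤ ‖f‖ := by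
  refine ContinuousLinearMap.opNorm_le_bound _ (norm_nonneg _) fun ξ => ?_
  have h : ∀ η, ‖⟪η, π.integrated f ξ⟫_ℂ‖ ≤ ‖f‖ * ‖ξ‖ * ‖η‖ := by
    intro η
    rw [inner_integrated]
    calc ‖∫ s, f s * π.coeff ξ η s ∂μ‖
        ≤ ∫ s, ‖f s‖ * (‖η‖ * ‖ξ‖) ∂μ := by
          refine norm_integral_le_of_norm_le ((L1.integrable_coeFn f).norm.mul_const _)
            (.of_forall fun s => ?_)
          rw [norm_mul]
          exact mul_le_mul_of_nonneg_left (π.norm_coeff_le ξ η s) (norm_nonneg _)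
      _ = ‖f‖ * ‖ξ‖ * ‖η‖ := by
          rw [integral_mul_const, ← L1.norm_eq_integral_norm]
          ring
  have h1 := h (π.integrated f ξ)
  rw [inner_self_eq_norm_sq_to_K, norm_pow, RCLike.norm_ofReal, abs_norm, sq] at h1
  rcases (norm_nonneg (π.integrated f ξ)).eq_or_lt with h0 | h0
  · rw [← h0]; positivity
  · exact le_of_mul_le_mul_right h1 h0

theorem continuous_norm_integrated (π : UnitaryRep G H) :
    Continuous fun f : G →₁[μ] ℂ => ‖π.integrated f‖ := by
  refine (LipschitzWith.of_dist_le_mul (K := 1) fun f g => ?_ :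
    LipschitzWith 1 fun f : G →₁[μ] ℂ => π.integrated f).continuous.norm
  rw [dist_eq_norm, dist_eq_norm, ← integrated_sub, NNReal.coe_one, one_mul]
  exact π.norm_integrated_le _

end

variable (μ : Measure G) [IsFiniteMeasureOnCompacts μ]

/-- The integrated form of a representation at a continuous function with compact support. -/
noncomputable def integratedCc (π : UnitaryRep G H) (g : C_c(G, ℂ)) : H →L[ℂ] H :=
  π.integrated (g.toLp μ 1)

theorem inner_integratedCc (π : UnitaryRep G H) (g : C_c(G, ℂ)) (ξ η : H) :
    ⟪η, π.integratedCc μ g ξ⟫_ℂ = ∫ s, g s * ⟪η, π.toHom s ξ⟫_ℂ ∂μ := by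
  rw [integratedCc, inner_integrated]
  refine integral_congr_ae ?_
  filter_upwards [g.coeFn_toLp μ 1] with s hs
  rw [hs, coeff]

theorem inner_integratedCc_adjoint (π : UnitaryRep G H) (g : C_c(G, ℂ)) (ξ η : H) :
    ⟪η, (π.integratedCc μ g).adjoint ξ⟫_ℂ = ∫ s, conj (g s) * ⟪η, π.toHom s⁻¹ ξ⟫_ℂ ∂μ := by
  rw [integratedCc, inner_integrated_adjoint]
  refine integral_congr_ae ?_
  filter_upwards [g.coeFn_toLp μ 1] with s hs
  rw [hs]

omit [CompleteSpace H] in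
theorem integrable_mul_inner (π : UnitaryRep G H) (g : C_c(G, ℂ)) (ξ η : H) :
    Integrable (fun s => g s * ⟪η, π.toHom s ξ⟫_ℂ) μ :=
  (g.continuous.mul (π.continuous_coeff ξ η)).integrable_of_hasCompactSupport
    g.hasCompactSupport.mul_right

theorem integratedCc_add (π : UnitaryRep G H) (g h : C_c(G, ℂ)) :
    π.integratedCc μ (g + h) = π.integratedCc μ g + π.integratedCc μ h := by
  ext ξ
  refine ext_inner_left ℂ fun η => ?_
  rw [_root_.add_apply, inner_add_right, inner_integratedCc, inner_integratedCc,
    inner_integratedCc, ← integral_add (π.integrable_mul_inner μ g ξ η)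
    (π.integrable_mul_inner μ h ξ η)]
  simp [add_mul]

theorem integratedCc_smul (π : UnitaryRep G H) (c : ℂ) (g : C_c(G, ℂ)) :
    π.integratedCc μ (c • g) = c • π.integratedCc μ g := by
  ext ξ
  refine ext_inner_left ℂ fun η => ?_
  rw [_root_.smul_apply, inner_smul_right, inner_integratedCc, inner_integratedCc,
    ← integral_const_mul]
  simp [mul_assoc]

/-- The subspace of vectors `π(g)ξ` with `g` continuous of compact support. -/
noncomputable def gardingSpace (π : UnitaryRep G H) (ξ : H) : Submodule ℂ H where
  carrier := Set.range fun g : C_c(G, ℂ) => π.integratedCc μ g ξ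
  add_mem' := by
    rintro _ _ ⟨g, rfl⟩ ⟨h, rfl⟩
    exact ⟨g + h, by simp [integratedCc_add]⟩
  zero_mem' := ⟨(0 : ℂ) • 0, by
    change π.integratedCc μ ((0 : ℂ) • 0) ξ = 0
    rw [integratedCc_smul]; simp⟩
  smul_mem' := by
    rintro c _ ⟨g, rfl⟩
    exact ⟨c • g, by simp [integratedCc_smul]⟩

variable [IsTopologicalGroup G] [LocallyCompactSpace G] [T2Space G]

-- A vector `ζ` orthogonal to every `π(g)ξ` has vanishing coefficient against `ξ`, hence is
-- orthogonal to the orbit of `ξ`.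
omit [T2Space G] in
theorem dense_gardingSpace [μ.IsOpenPosMeasure] (π : UnitaryRep G H) {ξ : H}
    (hξ : π.IsCyclicVector ξ) : Dense (π.gardingSpace μ ξ : Set H) := by
  rw [Submodule.dense_iff_topologicalClosure_eq_top, Submodule.topologicalClosure_eq_top_iff,
    Submodule.eq_bot_iff]
  intro ζ hζ
  have key : ∀ s, ⟪ζ, π.toHom s ξ⟫_ℂ = 0 := by
    intro s
    by_contra hs
    obtain ⟨ψ, hψc, hψ0, hψs⟩ := exists_continuous_nonneg_pos s
    let c : G → ℂ := fun t => ⟪ζ, π.toHom t ξ⟫_ℂ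
    have hc : Continuous c := π.continuous_coeff ξ ζ
    -- This choice makes `g * c = ψ * ‖c‖²`, whose integral is positive if `c s ≠ 0`.
    let g : C_c(G, ℂ) := ⟨⟨fun t => (ψ t : ℂ) * conj (c t), by fun_prop⟩,
      (hψc.comp_left (g := Complex.ofReal) Complex.ofReal_zero).mul_right⟩
    have h0 : ∫ t, g t * c t ∂μ = 0 := by
      rw [← inner_integratedCc μ π g ξ ζ]
      exact Submodule.inner_left_of_mem_orthogonal (K := π.gardingSpace μ ξ) ⟨g, rfl⟩ hζ
    have h1 : ∀ t, g t * c t = ((ψ t * ‖c t‖ ^ 2 : ℝ) : ℂ) := by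
      intro t
      change (ψ t : ℂ) * conj (c t) * c t = _
      rw [mul_assoc, Complex.conj_mul']
      push_cast
      rfl
    simp_rw [h1] at h0
    rw [integral_complex_ofReal, Complex.ofReal_eq_zero] at h0
    refine h0.not_gt (Continuous.integral_pos_of_hasCompactSupport_nonneg_nonzero (x := s)
      (by fun_prop) hψc.mul_right (fun t => mul_nonneg (hψ0 t) (by positivity)) ?_)
    exact mul_ne_zero hψs (pow_ne_zero _ (norm_ne_zero_iff.2 hs))
  refine hξ.eq_zero_of_inner_left ℂ fun v hv => ?_
  refine Submodule.span_induction ?_ (inner_zero_right _) ?_ ?_ hv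
  · rintro _ ⟨s, rfl⟩
    exact key s
  · intro x y _ _ hx hy
    rw [inner_add_right, hx, hy, add_zero]
  · intro a x _ hx
    rw [inner_smul_right, hx, mul_zero]

variable [μ.IsMulLeftInvariant]

-- Serves both `π(f)` (with `θ = id`) and its adjoint (with `conj f` and `θ` the inverse). Twisting
-- by `θ` instead of substituting `s ↦ s⁻¹` keeps the modular function out.
omit [LocallyCompactSpace G] [T2Space G] in
theorem apply_integratedCc_of_inner_eq (π : UnitaryRep G H) (f g : C_c(G, ℂ)) (θ : C(G, G))
    (B : H →L[ℂ] H) (hB : ∀ η ζ, ⟪ζ, B η⟫_ℂ = ∫ s, f s * ⟪ζ, π.toHom (θ s) η⟫_ℂ ∂μ) (ξ : H) :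
    B (π.integratedCc μ g ξ) = π.integratedCc μ (twistedConv μ f θ g) ξ := by
  refine ext_inner_left ℂ fun ζ => ?_
  rw [hB, inner_integratedCc, integral_twistedConv_mul μ f θ g
    (c := fun s => ⟪ζ, π.toHom s ξ⟫_ℂ) (π.continuous_coeff ξ ζ)]
  congr 1
  ext s
  congr 1
  have h : ∀ η, ⟪ζ, π.toHom (θ s) η⟫_ℂ = ⟪(π.toHom (θ s)).symm ζ, η⟫_ℂ := fun η => by
    rw [← LinearIsometryEquiv.inner_map_map (π.toHom (θ s)) ((π.toHom (θ s)).symm ζ),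
      LinearIsometryEquiv.apply_symm_apply]
  rw [h, inner_integratedCc]
  congr 1
  ext t
  rw [map_mul, LinearIsometryEquiv.coe_mul, Function.comp_apply, h]

end UnitaryRep

/-! ### Log-convex sequences and self-adjoint operators -/

/-- Log-convexity keeps every ratio `b (n + 1) / b n` at least `b 1 / b 0`, so `b` grows at least
like `(b 1 / b 0) ^ n`; a first ratio above `r` would outgrow `C * r ^ n`. -/
theorem le_mul_of_sq_le_mul_of_le_mul_pow {b : ℕ → ℝ} (hb : ∀ n, 0 ≤ b n)
    (hlog : ∀ n, b (n + 1) ^ 2 ≤ b n * b (n + 2)) {C r : ℝ} (hr : 0 ≤ r)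
    (hC : ∀ n, b n ≤ C * r ^ n) : b 1 ≤ r * b 0 := by
  by_contra! hlt
  have h1 : 0 < b 1 := (mul_nonneg hr (hb 0)).trans_lt hlt
  have h0 : 0 < b 0 := by
    refine (hb 0).lt_of_ne fun h => ?_
    have := hlog 0
    rw [← h, zero_mul] at this
    exact (pow_pos h1 2).not_ge this
  have hstep : ∀ n, 0 < b n ∧ b n * b 1 ≤ b (n + 1) * b 0 := by
    intro n
    induction n with
    | zero => exact ⟨h0, (mul_comm _ _).le⟩
    | succ n ih =>
      obtain ⟨hn, hn1⟩ := ih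
      have hpos : 0 < b (n + 1) := pos_of_mul_pos_left ((mul_pos hn h1).trans_le hn1) h0.le
      refine ⟨hpos, le_of_mul_le_mul_left ?_ hn⟩
      calc b n * (b (n + 1) * b 1) = b (n + 1) * (b n * b 1) := by ring
        _ ≤ b (n + 1) * (b (n + 1) * b 0) := mul_le_mul_of_nonneg_left hn1 hpos.le
        _ = b (n + 1) ^ 2 * b 0 := by ring
        _ ≤ b n * b (n + 2) * b 0 := mul_le_mul_of_nonneg_right (hlog n) h0.le
        _ = _ := by ring
  have hgeom : ∀ n, b 0 * (b 1 / b 0) ^ n ≤ b n := by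
    intro n
    induction n with
    | zero => simp
    | succ n ih =>
      calc b 0 * (b 1 / b 0) ^ (n + 1) = b 0 * (b 1 / b 0) ^ n * (b 1 / b 0) := by ring
        _ ≤ b n * (b 1 / b 0) := mul_le_mul_of_nonneg_right ih (by positivity)
        _ = b n * b 1 / b 0 := by ring
        _ ≤ b (n + 1) := (div_le_iff₀ h0).2 (hstep n).2
  have hq : 0 < b 1 / b 0 := by positivity
  have hrq : r / (b 1 / b 0) < 1 := by rwa [div_lt_one hq, lt_div_iff₀ h0]
  have hlim := (tendsto_pow_atTop_nhds_zero_of_lt_one (by positivity) hrq).const_mul C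
  rw [mul_zero] at hlim
  refine h0.not_ge (ge_of_tendsto' hlim fun n => ?_)
  rw [div_pow, ← mul_div_assoc, le_div_iff₀ (pow_pos hq n)]
  exact (hgeom n).trans (hC n)

/-- Cauchy–Schwarz on `‖Tⁿ⁺¹η‖² = ⟨Tⁿη, Tⁿ⁺²η⟩` gives log-convexity, which stands in for the
spectral theorem. -/
theorem norm_apply_le_of_isSelfAdjoint_of_norm_iterate_le {H : Type*} [NormedAddCommGroup H]
    [InnerProductSpace ℂ H] [CompleteSpace H] {T : H →L[ℂ] H} (hT : IsSelfAdjoint T) {η : H}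
    {C r : ℝ} (hr : 0 ≤ r) (h : ∀ n, ‖T^[n] η‖ ^ 2 ≤ C * (r ^ 2) ^ n) : ‖T η‖ ≤ r * ‖η‖ := by
  have key := le_mul_of_sq_le_mul_of_le_mul_pow (b := fun n => ‖T^[n] η‖ ^ 2)
    (fun n => by positivity) (fun n => ?_) (sq_nonneg r) h
  · simp only [Function.iterate_one, Function.iterate_zero, id_eq, ← mul_pow] at key
    exact (sq_le_sq₀ (norm_nonneg _) (by positivity)).1 key
  · rw [← mul_pow]
    refine pow_le_pow_left₀ (by positivity) ?_ 2
    have h1 : ((‖T^[n + 1] η‖ : ℂ)) ^ 2 = ⟪T^[n] η, T^[n + 2] η⟫_ℂ := by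
      rw [Function.iterate_succ_apply' T (n + 1), ← ContinuousLinearMap.adjoint_inner_left,
        hT.adjoint_eq, ← Function.iterate_succ_apply' T n]
      exact (inner_self_eq_norm_sq_to_K (𝕜 := ℂ) (T^[n + 1] η)).symm
    have h2 : ‖T^[n + 1] η‖ ^ 2 = ‖⟪T^[n] η, T^[n + 2] η⟫_ℂ‖ := by
      rw [← h1, norm_pow, Complex.norm_real, norm_norm]
    rw [h2]
    exact norm_inner_le_norm (𝕜 := ℂ) _ _

/-! ### Exponential growth of the measure of product sets -/

section MeasureGrowth

variable {G : Type*} [Group G] [TopologicalSpace G] [IsTopologicalGroup G]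
  [MeasurableSpace G] [BorelSpace G]

omit [TopologicalSpace G] [IsTopologicalGroup G] [BorelSpace G] in
theorem measure_finset_mul_le (μ : Measure G) [μ.IsMulLeftInvariant] (F : Finset G) (B : Set G) :
    μ ((F : Set G) * B) ≤ F.card * μ B := by
  have h : (F : Set G) * B = ⋃ x ∈ F, x • B := by
    ext y
    simp [Set.mem_mul, Set.mem_smul_set]
  rw [h]
  refine (measure_biUnion_finset_le F _).trans ?_
  simp [measure_smul]

omit [MeasurableSpace G] [BorelSpace G] in
theorem IsCompact.exists_subset_finset_mul {K V : Set G} (hK : IsCompact K)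
    (hV : (interior V).Nonempty) : ∃ F : Finset G, K ⊆ (F : Set G) * V := by
  classical
  obtain ⟨t, ht⟩ := compact_covered_by_mul_left_translates hK hV
  refine ⟨t.image (·⁻¹), fun x hx => ?_⟩
  obtain ⟨g, hg, hgx⟩ := Set.mem_iUnion₂.1 (ht hx)
  exact ⟨g⁻¹, by simpa using hg, g * x, hgx, by simp⟩

-- For a compact neighbourhood `N` of `1`, finitely many left translates of `N` cover `N * Q`, so by
-- left invariance each further factor `Q` multiplies the bound by their number.
omit [BorelSpace G] in
theorem exists_measure_mul_pow_mul_le [LocallyCompactSpace G] (μ : Measure G)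
    [μ.IsMulLeftInvariant] [IsFiniteMeasureOnCompacts μ] {P Q K : Set G} (hP : IsCompact P)
    (hQ : IsCompact Q) (hK : IsCompact K) :
    ∃ C M : ℝ, 0 < C ∧ 0 < M ∧ ∀ n : ℕ, (μ (P * (Q ^ n * K))).toReal ≤ C * M ^ n := by
  obtain ⟨N, hN, hN1⟩ := exists_compact_mem_nhds (1 : G)
  have hNi : (interior N).Nonempty := ⟨1, mem_interior_iff_mem_nhds.2 hN1⟩
  obtain ⟨F₀, hF₀⟩ := hP.exists_subset_finset_mul hNi
  obtain ⟨F, hF⟩ := (hN.mul hQ).exists_subset_finset_mul hNi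
  have hfin : μ (N * K) ≠ ⊤ := (hN.mul hK).measure_ne_top
  have hn : ∀ n : ℕ, μ (N * (Q ^ n * K)) ≤ (F.card : ENNReal) ^ n * μ (N * K) := by
    intro n
    induction n with
    | zero => simp
    | succ n ih =>
      calc μ (N * (Q ^ (n + 1) * K)) ≤ μ ((F : Set G) * (N * (Q ^ n * K))) := by
            refine measure_mono ?_
            rw [pow_succ', mul_assoc, ← mul_assoc N Q, ← mul_assoc (F : Set G)]
            exact Set.mul_subset_mul_right hF
        _ ≤ F.card * μ (N * (Q ^ n * K)) := measure_finset_mul_le μ F _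
        _ ≤ F.card * ((F.card : ENNReal) ^ n * μ (N * K)) := by gcongr
        _ = _ := by ring
  refine ⟨F₀.card * (μ (N * K)).toReal + 1, F.card + 1, by positivity, by positivity, fun n => ?_⟩
  have h1 : μ (P * (Q ^ n * K)) ≤ F₀.card * ((F.card : ENNReal) ^ n * μ (N * K)) := by
    calc μ (P * (Q ^ n * K)) ≤ μ ((F₀ : Set G) * (N * (Q ^ n * K))) := by
          refine measure_mono ?_
          rw [← mul_assoc (F₀ : Set G)]
          exact Set.mul_subset_mul_right hF₀
      _ ≤ F₀.card * μ (N * (Q ^ n * K)) := measure_finset_mul_le μ F₀ _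
      _ ≤ _ := by gcongr; exact hn n
  have h2 := ENNReal.toReal_mono (by finiteness) h1
  simp only [ENNReal.toReal_mul, ENNReal.toReal_pow, ENNReal.toReal_natCast] at h2
  calc (μ (P * (Q ^ n * K))).toReal
      ≤ F₀.card * ((F.card : ℝ) ^ n * (μ (N * K)).toReal) := h2
    _ = F₀.card * (μ (N * K)).toReal * (F.card : ℝ) ^ n := by ring
    _ ≤ _ := by gcongr <;> linarith

end MeasureGrowth

/-! ### Hölder's inequality on the support -/

/-- Cauchy–Schwarz against `φ` cut off to `S`, then the inclusion of `Lᵖ` in `L²` on a set of finite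
measure. -/
theorem norm_integral_mul_le_of_support_subset {X : Type*} [TopologicalSpace X]
    [MeasurableSpace X] [BorelSpace X] (μ : Measure X) [IsFiniteMeasureOnCompacts μ]
    (u : C_c(X, ℂ)) {S : Set X} (hS : MeasurableSet S) (hμS : μ S ≠ ⊤)
    (hu : Function.support u ⊆ S) {φ : X → ℂ} {p : ENNReal} (hp : 2 ≤ p) (hφ : MemLp φ p μ) :
    ‖∫ x, u x * φ x ∂μ‖ ≤
      ‖u.toLp μ 2‖ * ((eLpNorm φ p μ).toReal * (μ S).toReal ^ (1 / 2 - 1 / p.toReal)) := by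
  have : IsFiniteMeasure (μ.restrict S) := ⟨by simpa using hμS.lt_top⟩
  have hψ : MemLp (fun x => conj (φ x)) p μ := hφ.star
  have hψ2 : MemLp (fun x => conj (φ x)) 2 (μ.restrict S) := (hψ.restrict S).mono_exponent hp
  have hv : MemLp (S.indicator fun x => conj (φ x)) 2 μ := (memLp_indicator_iff_restrict hS).2 hψ2
  have h1 : ∫ x, u x * φ x ∂μ = ⟪hv.toLp _, u.toLp μ 2⟫_ℂ := by
    rw [L2.inner_def]
    refine integral_congr_ae ?_
    filter_upwards [hv.coeFn_toLp, u.coeFn_toLp μ 2] with x h1 h2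
    rw [h1, h2, RCLike.inner_apply]
    by_cases hx : x ∈ S
    · simp [hx]
    · have : u x = 0 := by
        by_contra h
        exact hx (hu h)
      simp [this]
  have h2 : ‖hv.toLp _‖ ≤ (eLpNorm φ p μ).toReal * (μ S).toReal ^ (1 / 2 - 1 / p.toReal) := by
    have hexp : (0 : ℝ) ≤ 1 / 2 - 1 / p.toReal := by
      -- For `p = ⊤`, `p.toReal = 0` and `1 / 0 = 0`, so the exponent is `1 / 2`, as it should be.
      rcases eq_or_ne p ⊤ with rfl | htop
      · simp
      · have : (2 : ℝ) ≤ p.toReal := by simpa using ENNReal.toReal_mono htop hp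
        rw [sub_nonneg]
        exact one_div_le_one_div_of_le two_pos this
    rw [Lp.norm_toLp, ENNReal.toReal_rpow, ← ENNReal.toReal_mul]
    refine ENNReal.toReal_mono (ENNReal.mul_ne_top hφ.2.ne
      (ENNReal.rpow_ne_top_of_nonneg hexp hμS)) ?_
    rw [eLpNorm_indicator_eq_eLpNorm_restrict hS]
    refine (eLpNorm_le_eLpNorm_mul_rpow_measure_univ hp hψ2.1).trans ?_
    rw [Measure.restrict_apply_univ, ENNReal.toReal_ofNat]
    gcongr
    refine (eLpNorm_mono_measure _ Measure.restrict_le_self).trans (le_of_eq ?_)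
    exact eLpNorm_congr_norm_ae (.of_forall fun x => RCLike.norm_conj _)
  rw [h1, mul_comm ‖u.toLp μ 2‖]
  exact (norm_inner_le_norm _ _).trans (by gcongr)

/-! ### Comparison with the regular representation -/

section Main

variable {G : Type*} [Group G] [TopologicalSpace G] [IsTopologicalGroup G]
  [MeasurableSpace G] [BorelSpace G]

/-- The function `t ↦ ∫ conj f(s) g(s t) ds`, which represents the adjoint of convolution by `f`
applied to `g`. -/
noncomputable def adjointConv (μ : Measure G) [IsFiniteMeasureOnCompacts μ] (f g : C_c(G, ℂ)) :
    C_c(G, ℂ) :=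
  twistedConv μ f.conjugate ⟨fun s => s⁻¹, continuous_inv⟩ g

/-- Convolution by `f` followed by its adjoint. -/
noncomputable def adjointConvConv (μ : Measure G) [IsFiniteMeasureOnCompacts μ]
    (f g : C_c(G, ℂ)) : C_c(G, ℂ) :=
  adjointConv μ f (twistedConv μ f (ContinuousMap.id G) g)

theorem support_adjointConv_subset (μ : Measure G) [IsFiniteMeasureOnCompacts μ]
    (f g : C_c(G, ℂ)) :
    Function.support (adjointConv μ f g) ⊆ (Function.support f)⁻¹ * Function.support g := by
  refine (support_twistedConv_subset μ f.conjugate g _).trans (Set.mul_subset_mul_right ?_)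
  rw [f.support_conjugate]
  exact (Set.image_inv_eq_inv (s := Function.support f)).subset

theorem support_iterate_adjointConvConv_subset (μ : Measure G) [IsFiniteMeasureOnCompacts μ]
    (f g : C_c(G, ℂ)) (n : ℕ) :
    Function.support ((adjointConvConv μ f)^[n] g) ⊆
      ((Function.support f)⁻¹ * Function.support f) ^ n * Function.support g := by
  induction n with
  | zero => simp
  | succ n ih =>
    rw [Function.iterate_succ_apply', pow_succ', mul_assoc, mul_assoc]
    refine (support_adjointConv_subset μ f _).trans (Set.mul_subset_mul_left ?_)
    refine (support_twistedConv_subset μ f _ _).trans ?_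
    rw [ContinuousMap.coe_id, Set.image_id]
    exact Set.mul_subset_mul_left ih

namespace UnitaryRep

section

variable (μ : Measure G) [IsFiniteMeasureOnCompacts μ] [μ.IsMulLeftInvariant]
  {H : Type*} [NormedAddCommGroup H] [InnerProductSpace ℂ H] [CompleteSpace H]

theorem integratedCc_adjoint_apply_integratedCc (π : UnitaryRep G H) (f g : C_c(G, ℂ)) (ξ : H) :
    (π.integratedCc μ f).adjoint (π.integratedCc μ g ξ) =
      π.integratedCc μ (adjointConv μ f g) ξ :=
  π.apply_integratedCc_of_inner_eq μ f.conjugate g _ _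
    (fun η ζ => π.inner_integratedCc_adjoint μ f η ζ) ξ

theorem iterate_adjoint_mul_apply_integratedCc (π : UnitaryRep G H) (f g : C_c(G, ℂ)) (ξ : H)
    (n : ℕ) :
    ((π.integratedCc μ f).adjoint * π.integratedCc μ f)^[n] (π.integratedCc μ g ξ) =
      π.integratedCc μ ((adjointConvConv μ f)^[n] g) ξ := by
  induction n with
  | zero => rfl
  | succ n ih =>
    rw [Function.iterate_succ_apply', ih, Function.iterate_succ_apply',
      mul_apply_eq_comp,
      π.apply_integratedCc_of_inner_eq μ f _ (ContinuousMap.id G) _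
        (fun η ζ => π.inner_integratedCc μ f η ζ),
      integratedCc_adjoint_apply_integratedCc]
    rfl

end

variable [LocallyCompactSpace G] [T2Space G] (μ : Measure G) [μ.IsHaarMeasure] [μ.Regular]

/-- The `L²` counterpart of `apply_integratedCc_of_inner_eq`, tested against the dense image of
`C_c`. The same function thus represents the operators on both sides of the comparison. -/
theorem apply_toLp_of_inner_eq (f g : C_c(G, ℂ)) (θ : C(G, G))
    (B : Lp ℂ 2 μ →L[ℂ] Lp ℂ 2 μ)
    (hB : ∀ η ζ, ⟪ζ, B η⟫_ℂ = ∫ s, f s * ⟪ζ, (leftRegular μ).toHom (θ s) η⟫_ℂ ∂μ) :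
    B (g.toLp μ 2) = (twistedConv μ f θ g).toLp μ 2 := by
  refine (CompactlySupportedContinuousMap.denseRange_toLp μ (p := 2) (by simp)).eq_of_inner_right ℂ
    fun h => ?_
  have h1 : ∀ u : C_c(G, ℂ), ⟪h.toLp μ 2, u.toLp μ 2⟫_ℂ = ∫ t, u t * conj (h t) ∂μ := by
    intro u
    rw [L2.inner_def]
    refine integral_congr_ae ?_
    filter_upwards [h.coeFn_toLp μ 2, u.coeFn_toLp μ 2] with t h1 h2
    rw [h1, h2, RCLike.inner_apply]
  have h2 : ∀ s : G, ⟪h.toLp μ 2, (leftRegular μ).toHom s (g.toLp μ 2)⟫_ℂ =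
      ∫ t, g t * conj (h (s * t)) ∂μ := by
    intro s
    rw [← integral_mul_left_eq_self (fun t => g t * conj (h (s * t))) s⁻¹, L2.inner_def]
    refine integral_congr_ae ?_
    have h3 := (measurePreserving_mul_left μ s⁻¹).quasiMeasurePreserving.ae_eq_comp
      (g.coeFn_toLp μ 2)
    filter_upwards [h.coeFn_toLp μ 2, leftTranslation_apply_ae μ s (g.toLp μ 2), h3]
      with t h1 h2 h3
    rw [RCLike.inner_apply, h1]
    simp only [Function.comp_apply] at h3
    rw [mul_inv_cancel_left, ← h3, ← h2]
    rfl
  rw [hB, h1, integral_twistedConv_mul μ f θ g (c := fun t => conj (h t)) (by fun_prop)]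
  simp_rw [h2]

theorem integratedCc_leftRegular_adjoint_apply_toLp (f g : C_c(G, ℂ)) :
    ((leftRegular μ).integratedCc μ f).adjoint (g.toLp μ 2) = (adjointConv μ f g).toLp μ 2 :=
  apply_toLp_of_inner_eq μ f.conjugate g _ _
    (fun η ζ => (leftRegular μ).inner_integratedCc_adjoint μ f η ζ)

theorem integratedCc_leftRegular_apply_toLp (f g : C_c(G, ℂ)) :
    (leftRegular μ).integratedCc μ f (g.toLp μ 2) =
      (twistedConv μ f (ContinuousMap.id G) g).toLp μ 2 :=
  apply_toLp_of_inner_eq μ f g _ _ (fun η ζ => (leftRegular μ).inner_integratedCc μ f η ζ)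

theorem norm_toLp_adjointConv_le (f g : C_c(G, ℂ)) :
    ‖(adjointConv μ f g).toLp μ 2‖ ≤ ‖(leftRegular μ).integratedCc μ f‖ * ‖g.toLp μ 2‖ := by
  rw [← integratedCc_leftRegular_adjoint_apply_toLp]
  refine (ContinuousLinearMap.le_opNorm _ _).trans_eq ?_
  rw [LinearIsometryEquiv.norm_map]

theorem norm_toLp_iterate_adjointConvConv_le (f g : C_c(G, ℂ)) (n : ℕ) :
    ‖((adjointConvConv μ f)^[n] g).toLp μ 2‖ ≤
      (‖(leftRegular μ).integratedCc μ f‖ ^ 2) ^ n * ‖g.toLp μ 2‖ := by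
  induction n with
  | zero => simp
  | succ n ih =>
    rw [Function.iterate_succ_apply']
    refine (norm_toLp_adjointConv_le μ f _).trans ?_
    rw [← integratedCc_leftRegular_apply_toLp, pow_succ', sq, mul_assoc, mul_assoc]
    gcongr
    refine (ContinuousLinearMap.le_opNorm _ _).trans ?_
    gcongr
    rw [← sq]
    exact ih

variable {H : Type*} [NormedAddCommGroup H] [InnerProductSpace ℂ H] [CompleteSpace H]

/-- The base `M` comes only from the supports of `f` and `g`; its place before `ε` is what permits
`ε → 0`. -/
theorem exists_growth_norm_adjoint_mul_apply_le (π : UnitaryRep G H) (ξ : H)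
    (hL : ∀ ε : ℝ, 0 < ε → MemLp (π.coeff ξ ξ) (ENNReal.ofReal (2 + ε)) μ) (f g : C_c(G, ℂ)) :
    ∃ M : ℝ, 0 < M ∧ ∀ ε : ℝ, 0 < ε →
      ‖((π.integratedCc μ f).adjoint * π.integratedCc μ f) (π.integratedCc μ g ξ)‖ ≤
        ‖(leftRegular μ).integratedCc μ f‖ ^ 2 * M ^ (1 / 2 - 1 / (2 + ε)) *
          ‖π.integratedCc μ g ξ‖ := by
  have hf := f.hasCompactSupport.isCompact
  have hg := g.hasCompactSupport.isCompact
  obtain ⟨C, M, hC, hM, hCM⟩ := exists_measure_mul_pow_mul_le μ hg.inv (hf.inv.mul hf) hg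
  refine ⟨M, hM, fun ε hε => ?_⟩
  set A := π.integratedCc μ f with hA
  set T := A.adjoint * A with hTdef
  set η := π.integratedCc μ g ξ with hη
  set Λ := ‖(leftRegular μ).integratedCc μ f‖ with hΛ
  set δ : ℝ := 1 / 2 - 1 / (2 + ε) with hδ
  have hδ0 : 0 ≤ δ := sub_nonneg.2 (one_div_le_one_div_of_le two_pos (by linarith))
  have hT : IsSelfAdjoint T := IsSelfAdjoint.star_mul_self A
  have hp2 : (2 : ENNReal) ≤ ENNReal.ofReal (2 + ε) := by
    rw [← ENNReal.ofReal_ofNat]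
    exact ENNReal.ofReal_le_ofReal (by linarith)
  have hpr : (ENNReal.ofReal (2 + ε)).toReal = 2 + ε := ENNReal.toReal_ofReal (by linarith)
  set N := (eLpNorm (π.coeff ξ ξ) (ENNReal.ofReal (2 + ε)) μ).toReal
  set B := ‖(leftRegular μ).integratedCc μ g‖
  refine norm_apply_le_of_isSelfAdjoint_of_norm_iterate_le hT (by positivity)
    (C := B * ‖g.toLp μ 2‖ * N * C ^ δ) fun n => ?_
  -- Chosen so that `π(w)ξ = π(g)* T²ⁿ π(g)ξ`; the `2n` arises from moving `Tⁿ` across the inner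
  -- product.
  set w := adjointConv μ g ((adjointConvConv μ f)^[2 * n] g) with hw
  have hadj : ∀ (k : ℕ) (x y : H), ⟪T^[k] x, y⟫_ℂ = ⟪x, T^[k] y⟫_ℂ := by
    intro k
    induction k with
    | zero => simp
    | succ k ih =>
      intro x y
      rw [Function.iterate_succ_apply, ih, Function.iterate_succ_apply' T k y,
        ← ContinuousLinearMap.adjoint_inner_right, hT.adjoint_eq]
  have h1 : ((‖T^[n] η‖ ^ 2 : ℝ) : ℂ) = ∫ s, w s * π.coeff ξ ξ s ∂μ := by
    have h2 : ⟪T^[n] η, T^[n] η⟫_ℂ = ⟪ξ, π.integratedCc μ w ξ⟫_ℂ := by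
      rw [hadj, ← Function.iterate_add_apply, ← two_mul,
        iterate_adjoint_mul_apply_integratedCc, hη, hw,
        ← integratedCc_adjoint_apply_integratedCc, ContinuousLinearMap.adjoint_inner_right]
    rw [inner_integratedCc, inner_self_eq_norm_sq_to_K] at h2
    rw [Complex.ofReal_pow]
    exact h2
  have h2 : ‖T^[n] η‖ ^ 2 = ‖∫ s, w s * π.coeff ξ ξ s ∂μ‖ := by
    rw [← h1, Complex.norm_real, Real.norm_eq_abs, abs_of_nonneg (by positivity)]
  have hcompact : ∀ k : ℕ, IsCompact (((tsupport f)⁻¹ * tsupport f) ^ k) := by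
    intro k
    induction k with
    | zero => simp
    | succ k ih => rw [pow_succ]; exact ih.mul (hf.inv.mul hf)
  have hS : IsCompact ((tsupport g)⁻¹ * (((tsupport f)⁻¹ * tsupport f) ^ (2 * n) * tsupport g)) :=
    hg.inv.mul ((hcompact _).mul hg)
  have hsupp : Function.support w ⊆
      (tsupport g)⁻¹ * (((tsupport f)⁻¹ * tsupport f) ^ (2 * n) * tsupport g) := by
    refine (support_adjointConv_subset μ g _).trans (Set.mul_subset_mul
      (Set.inv_subset_inv.2 (subset_tsupport _))
      ((support_iterate_adjointConvConv_subset μ f g _).trans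
        (Set.mul_subset_mul (Set.pow_subset_pow_left (Set.mul_subset_mul
          (Set.inv_subset_inv.2 (subset_tsupport _)) (subset_tsupport _))) (subset_tsupport _))))
  have h3 := norm_integral_mul_le_of_support_subset μ w hS.measurableSet hS.measure_ne_top hsupp
    hp2 (hL ε hε)
  rw [hpr] at h3
  rw [h2]
  calc _ ≤ _ := h3
    _ ≤ B * ((Λ ^ 2) ^ (2 * n) * ‖g.toLp μ 2‖) * (N * (C * M ^ (2 * n)) ^ δ) := by
        gcongr
        · exact (norm_toLp_adjointConv_le μ g _).trans
            (by gcongr; exact norm_toLp_iterate_adjointConvConv_le μ f g _)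
        · exact hCM _
    _ = _ := by
        -- `(M²ⁿ)^δ = (M^δ)²ⁿ`, so the growth rate is the square of `Λ² M^δ`.
        rw [Real.mul_rpow hC.le (by positivity), ← Real.rpow_natCast M, ← Real.rpow_mul hM.le,
          mul_comm _ δ, Real.rpow_mul hM.le, Real.rpow_natCast, ← pow_mul (_ * _), mul_pow]
        ring

theorem norm_integratedCc_le_leftRegular (π : UnitaryRep G H) {ξ : H} (hξ : π.IsCyclicVector ξ)
    (hL : ∀ ε : ℝ, 0 < ε → MemLp (π.coeff ξ ξ) (ENNReal.ofReal (2 + ε)) μ) (f : C_c(G, ℂ)) :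
    ‖π.integratedCc μ f‖ ≤ ‖(leftRegular μ).integratedCc μ f‖ := by
  set Λ := ‖(leftRegular μ).integratedCc μ f‖
  set T := (π.integratedCc μ f).adjoint * π.integratedCc μ f with hT
  have hdense : ∀ x ∈ π.gardingSpace μ ξ, ‖T x‖ ≤ Λ ^ 2 * ‖x‖ := by
    rintro _ ⟨g, rfl⟩
    obtain ⟨M, hM, h⟩ := exists_growth_norm_adjoint_mul_apply_le μ π ξ hL f g
    have hexp : Filter.Tendsto (fun ε : ℝ => 1 / 2 - 1 / (2 + ε)) (𝓝[>] 0) (𝓝 0) := by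
      have : ContinuousAt (fun ε : ℝ => 1 / 2 - 1 / (2 + ε)) 0 := by
        refine continuousAt_const.sub (continuousAt_const.div (by fun_prop) (by norm_num))
      have h0 := this.tendsto
      norm_num at h0
      norm_num
      exact h0.mono_left nhdsWithin_le_nhds
    have hlim := (((Real.continuousAt_const_rpow hM.ne').tendsto.comp hexp).const_mul
      (Λ ^ 2)).mul_const ‖π.integratedCc μ g ξ‖
    rw [Real.rpow_zero, mul_one] at hlim
    exact ge_of_tendsto hlim (Filter.eventually_of_mem self_mem_nhdsWithin fun ε hε => h ε hε)
  have hall : ∀ x, ‖T x‖ ≤ Λ ^ 2 * ‖x‖ := fun x =>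
    (isClosed_le T.continuous.norm (continuous_const.mul continuous_norm)).closure_subset_iff.2
      hdense (π.dense_gardingSpace μ hξ x)
  have h1 : ‖T‖ ≤ Λ ^ 2 := T.opNorm_le_bound (by positivity) hall
  -- The C*-identity.
  have h2 : ‖T‖ = ‖π.integratedCc μ f‖ * ‖π.integratedCc μ f‖ :=
    ContinuousLinearMap.norm_adjoint_comp_self _
  rw [h2, ← sq] at h1
  exact (sq_le_sq₀ (norm_nonneg _) (norm_nonneg _)).1 h1

end UnitaryRep

end Main

theorem mainTheorem6 {G : Type*} [Group G] [TopologicalSpace G] [IsTopologicalGroup G]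
    [LocallyCompactSpace G] [T2Space G] [MeasurableSpace G] [BorelSpace G]
    (μ : Measure G) [μ.IsHaarMeasure] [μ.Regular]
    {H : Type*} [NormedAddCommGroup H] [InnerProductSpace ℂ H] [CompleteSpace H]
    (π : UnitaryRep G H) (ξ : H) (hξ : π.IsCyclicVector ξ)
    (hL : ∀ ε : ℝ, 0 < ε → MemLp (π.coeff ξ ξ) (ENNReal.ofReal (2 + ε)) μ) :
    π.WeaklyContained μ (leftRegular μ) := by
  intro f
  -- Both operator norms are continuous in the `L¹` norm, so `C_c` suffices.
  exact (CompactlySupportedContinuousMap.denseRange_toLp μ (p := 1) (by simp)).induction_on f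
    (isClosed_le π.continuous_norm_integrated (leftRegular μ).continuous_norm_integrated)
    fun g => π.norm_integratedCc_le_leftRegular μ hξ hL g
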